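/- **First decomposition of global loops.** Let $\mathcal K=(V,E,F)$ be a finite triangulation (a regular CW complex whose cells are simplices) of a connected compact surface, with or without boundary, orientable or not, with arbitrarily oriented cells and incidence numbers $\iota(f,e)\in\{0,\pm1\}$. Let $\bar{\mathcal K}$ be the CW complex obtained from $\mathcal K$ by collapsing each connected component of $\partial\mathcal K$ to one $0$-cell: its $2$-cells are the faces of $\mathcal K$, its $1$-cells the edges of $\mathcal K$ not in $\partial\mathcal K$, and its $0$-cells the nodes of $\mathcal K$ with all nodes of one boundary component identified. A $1$-cochain of $\mathcal K$ that vanishes on all boundary edges is regarded as a $1$-cochain of $\bar{\mathcal K}$. *Trees.* Let $T$ be the edge set of a spanning tree of the $1$-skeleton of $\mathcal K$ that restricts to a spanning tree of each component of $\partial\mathcal K$. Let $S$ be a set of non-boundary edges not in $T$ whose dual edges (joining the two faces at the edge) form a spanning tree on the set of faces. Let $E_M$ be the set of the non-boundary edges that are in neither $T$ nor $S$. *Cochain of a path.* Let $f_1,\dots,f_l$ be distinct faces and $e_1,\dots,e_{l-1}$ distinct edges such that $e_i$ is shared by $f_i$ and $f_{i+1}$. Let $e$ be a side of $f_1$ and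 $e'$ a side of $f_l$, neither among the $e_i$. Put $e_0=e$, $e_l=e'$, $a_0=1$ and $a_i=-\frac{\iota(f_i,e_i)}{\iota(f_i,e_{i-1})}\,a_{i-1}$ for $1\le i\le l$. If $e'=e$ and $a_l\ne 1$, the cochain of the path and the pair $(e,e')$ is $0$; otherwise it is the $1$-cochain with the value $a_i$ on $e_i$ for $0\le i\le l$ and $0$ on all other edges. *Handle cochains.* For $e\in E_M$ let $f_e^{(1)},f_e^{(2)}$ be the two faces at $e$, in any order, and let $g_e$ be the cochain of the unique path in the dual tree $S$ from $f_e^{(1)}$ to $f_e^{(2)}$ and the pair $(e,e)$. Let $E_M^{\mathrm{II}}=\{e\in E_M: g_e=0\}$. 1. If $E_M^{\mathrm{II}}=\emptyset$, put $g_e^{\mathrm{ha}}=g_e$ for $e\in E_M$ and $\mathcal G^{\mathrm{ha}}=(g_e^{\mathrm{ha}})_{e\in E_M}$. 2. If $E_M^{\mathrm{II}}\neq\emptyset$, choose any $e^*\in E_M^{\mathrm{II}}$. For $e\in E_M\setminus E_M^{\mathrm{II}}$ put $g_e^{\mathrm{ha}}=g_e$. For $e\in E_M^{\mathrm{II}}\setminus\{e^*\}$,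 label the two faces at $e^*$ as $f_{e^*}^{(1)},f_{e^*}^{(2)}$ in any order and, for $k=1,2$, let $g_e^{(k)}$ be the cochain of the unique path in $S$ from $f_e^{(k)}$ to $f_{e^*}^{(k)}$ and the pair $(e,e^*)$; let $g_e^{\mathrm{ha}}$ be equal to $g_e^{(1)}$ on $e$ and $e^*$, and to $g_e^{(1)}+g_e^{(2)}$ on all other edges. Put $\mathcal G^{\mathrm{ha}}=(g_e^{\mathrm{ha}})_{e\in E_M\setminus\{e^*\}}$. Then, for all choices made, every member of $\mathcal G^{\mathrm{ha}}$ vanishes on the boundary edges and is a $1$-cocycle of $\bar{\mathcal K}$, and the cohomology classes of the members of the family $\mathcal G^{\mathrm{ha}}$ form a basis of $H^1(\bar{\mathcal K};\mathbb R)$. In particular $H^1(\bar{\mathcal K};\mathbb R)\cong\operatorname{span}\{[g]: g\in\mathcal G^{\mathrm{ha}}\}$, of dimension $|E_M|$ in case 1 and $|E_M|-1$ in case 2. -/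

import Mathlib

noncomputable section

/-- Combinatorial data of a finite regular two-dimensional CW complex all of whose cells are
simplices (`V`, `E`, `F` are the sets of nodes, edges and faces), together with an orientation of
every cell. Regularity means that an edge has two distinct end nodes and a face three distinct
corners; different cells may have the same corners. The edge `e` is oriented from `src e` to
`tgt e`; the face `f` has the corners `vert f 0, vert f 1, vert f 2`, is oriented in this cyclic
order, and its side `edge f i` joins `vert f i` to `vert f (i + 1)` (indices modulo 3). -/
structure TriComplex (V E F : Type*) where
  src : E → V
  tgt : E → V
  src_ne_tgt : ∀ e, src e ≠ tgt e
  vert : F → Fin 3 → V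
  vert_injective : ∀ f, Function.Injective (vert f)
  edge : F → Fin 3 → E
  edge_ends : ∀ f i, s(src (edge f i), tgt (edge f i)) = s(vert f i, vert f (i + 1))

namespace TriComplex

variable {V E F : Type*} (K : TriComplex V E F)

/-! ### Surfaces -/

/-- The edge `e` is a side of the face `f`. -/
def IsSide (e : E) (f : F) : Prop := ∃ i, K.edge f i = e

/-- The graph on all nodes formed by the edges in `S` (parallel edges are merged). -/
def graphOf (S : Set E) : SimpleGraph V :=
  SimpleGraph.fromEdgeSet ((fun e => s(K.src e, K.tgt e)) '' S)

/-- The link of the node `v`: its points are the edges at `v`, and two of them are adjacent when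
they are sides of a common face. -/
def link (v : V) : SimpleGraph {e : E // K.src e = v ∨ K.tgt e = v} where
  Adj a b := a ≠ b ∧ ∃ f, K.IsSide a.1 f ∧ K.IsSide b.1 f
  symm := ⟨fun _ _ h => ⟨h.1.symm, h.2.imp fun _ hf => ⟨hf.2, hf.1⟩⟩⟩
  loopless := ⟨fun _ h => h.1 rfl⟩

/-- `K` triangulates a connected surface (2-manifold), possibly with boundary: every edge is a
side of one or two faces, every link is connected (hence an arc or a circle), and the
1-skeleton is connected. -/
structure IsSurface : Prop where
  edge_faces : ∀ e, {f | K.IsSide e f}.ncard = 1 ∨ {f | K.IsSide e f}.ncard = 2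
  link_connected : ∀ v, (K.link v).Connected
  connected : (K.graphOf Set.univ).Connected

/-- The boundary edges: those that are a side of exactly one face. -/
def boundaryEdges : Set E := {e | {f | K.IsSide e f}.ncard = 1}

/-- The graph of the boundary, on all nodes; nodes that do not lie on the boundary are
isolated. -/
def boundaryGraph : SimpleGraph V := K.graphOf K.boundaryEdges

open scoped Classical in
/-- Incidence number of a face and an edge: `1` if the edge is a side of the face and is
traversed along its orientation by the oriented boundary of the face, `-1` if it is traversed
against its orientation, and `0` if it is not a side of the face. -/
def inc (f : F) (e : E) : ℤ :=
  ∑ i : Fin 3, if K.edge f i = e then (if K.src e = K.vert f i then 1 else -1) else 0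

/-! ### The closed complex obtained by collapsing the boundary components

Its 2-cells are the faces of `K`, its 1-cells the edges of `K` that are not on the boundary, and
its 0-cells the nodes of `K`, where all nodes of one boundary component are identified. -/

/-- The 0-cells of the closed complex. -/
def BarNode : Type _ := K.boundaryGraph.ConnectedComponent

/-- The 1-cells of the closed complex. -/
def BarEdge : Type _ := {e : E // e ∉ K.boundaryEdges}

instance [Finite V] : Finite K.BarNode :=
  Finite.of_surjective K.boundaryGraph.connectedComponentMk Quot.mk_surjective

instance [Finite E] : Finite K.BarEdge :=
  inferInstanceAs (Finite {e : E // e ∉ K.boundaryEdges})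

instance [Finite V] : Fintype K.BarNode := Fintype.ofFinite _

instance [Finite E] : Fintype K.BarEdge := Fintype.ofFinite _

/-- The 0-cell of the closed complex that contains a given node of `K`. -/
def toBarNode (v : V) : K.BarNode := K.boundaryGraph.connectedComponentMk v

open scoped Classical in
/-- Incidence number of a 1-cell and a 0-cell of the closed complex; it is `0` when the 1-cell is
a loop. -/
def barIncEdge (e : K.BarEdge) (n : K.BarNode) : ℤ :=
  (if K.toBarNode (K.tgt e.1) = n then 1 else 0) - (if K.toBarNode (K.src e.1) = n then 1 else 0)

/-- Incidence number of a 2-cell and a 1-cell of the closed complex. -/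
def barIncFace (f : F) (e : K.BarEdge) : ℤ := K.inc f e.1

/-- The coboundary map from 0-cochains to 1-cochains of the closed complex. -/
def barD0 [Finite V] : (K.BarNode → ℝ) →ₗ[ℝ] (K.BarEdge → ℝ) where
  toFun φ e := ∑ n, (K.barIncEdge e n : ℝ) * φ n
  map_add' φ ψ := by
    funext e; simp [mul_add, Finset.sum_add_distrib]
  map_smul' a φ := by
    funext e; simp [Finset.mul_sum, mul_left_comm]

/-- The coboundary map from 1-cochains to 2-cochains of the closed complex. -/
def barD1 [Finite E] : (K.BarEdge → ℝ) →ₗ[ℝ] (F → ℝ) where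
  toFun c f := ∑ e, (K.barIncFace f e : ℝ) * c e
  map_add' φ ψ := by
    funext e; simp [mul_add, Finset.sum_add_distrib]
  map_smul' a φ := by
    funext e; simp [Finset.mul_sum, mul_left_comm]

/-- The 1-cocycles of the closed complex. -/
abbrev barZ1 [Finite E] : Submodule ℝ (K.BarEdge → ℝ) := LinearMap.ker K.barD1

/-- The 1-coboundaries of the closed complex. -/
abbrev barB1 [Finite V] : Submodule ℝ (K.BarEdge → ℝ) := LinearMap.range K.barD0

/-- The coboundary of a coboundary is zero. -/
theorem barD1_barD0 [Finite V] [Finite E] (φ : K.BarNode → ℝ) : K.barD1 (K.barD0 φ) = 0 := by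
  classical
  let ψ : V → ℝ := fun v => φ (K.toBarNode v)
  have h0 : ∀ e, K.barD0 φ e = ψ (K.tgt e.1) - ψ (K.src e.1) := by
    intro e
    simp [barD0, barIncEdge, ψ, sub_mul, Finset.sum_sub_distrib]
  have hb : ∀ e ∈ K.boundaryEdges, ψ (K.tgt e) = ψ (K.src e) := by
    intro e he
    have : K.boundaryGraph.Adj (K.tgt e) (K.src e) := by
      simp only [boundaryGraph, graphOf, SimpleGraph.fromEdgeSet_adj]
      exact ⟨⟨e, he, Sym2.eq_swap⟩, (K.src_ne_tgt e).symm⟩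
    have h2 : K.toBarNode (K.tgt e) = K.toBarNode (K.src e) :=
      SimpleGraph.ConnectedComponent.sound this.reachable
    simp only [ψ, h2]
  funext f
  have h1 : K.barD1 (K.barD0 φ) f =
      ∑ e : K.BarEdge, (K.inc f e.1 : ℝ) * (ψ (K.tgt e.1) - ψ (K.src e.1)) := by
    simp [barD1, barIncFace, h0]
  rw [h1]
  have : Fintype E := Fintype.ofFinite E
  have h2 : ∑ e : K.BarEdge, (K.inc f e.1 : ℝ) * (ψ (K.tgt e.1) - ψ (K.src e.1)) =
      ∑ e : E, (K.inc f e : ℝ) * (ψ (K.tgt e) - ψ (K.src e)) := by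
    refine Finset.sum_of_injOn (fun e : K.BarEdge => e.1) ?_ ?_ ?_ ?_
    · intro a _ b _ hab; exact Subtype.ext hab
    · intro a _; simp
    · intro e _ he
      have : e ∈ K.boundaryEdges := by
        by_contra hne
        exact he ⟨⟨e, hne⟩, by rw [Finset.coe_univ]; trivial, rfl⟩
      rw [hb e this]; simp
    · intro a _; rfl
  rw [h2]
  have h3 : ∀ i, (∑ e : E, (if K.edge f i = e then
      (if K.src e = K.vert f i then (1 : ℝ) else -1) else 0) * (ψ (K.tgt e) - ψ (K.src e))) =
      ψ (K.vert f (i + 1)) - ψ (K.vert f i) := by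
    intro i
    simp only [ite_mul, zero_mul, Finset.sum_ite_eq, Finset.mem_univ, if_true]
    have h := K.edge_ends f i
    have hne := K.src_ne_tgt (K.edge f i)
    rw [Sym2.eq_iff] at h
    rcases h with ⟨ha, hb⟩ | ⟨ha, hb⟩
    · simp [ha, hb]
    · have : K.src (K.edge f i) ≠ K.vert f i := by rw [← hb]; exact hne
      rw [if_neg this, ha, hb]; ring
  have h4 : ∑ e : E, (K.inc f e : ℝ) * (ψ (K.tgt e) - ψ (K.src e)) =
      ∑ i : Fin 3, (ψ (K.vert f (i + 1)) - ψ (K.vert f i)) := by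
    simp_rw [← h3]
    rw [Finset.sum_comm]
    refine Finset.sum_congr rfl fun e _ => ?_
    simp only [inc]
    push_cast
    rw [Finset.sum_mul]
  rw [h4, Fin.sum_univ_three]
  simp only [Fin.isValue, zero_add, Pi.zero_apply]
  have e1 : (1 : Fin 3) + 1 = 2 := rfl
  have e2 : (2 : Fin 3) + 1 = 0 := rfl
  rw [e1, e2]; ring

theorem barB1_le_barZ1 [Finite V] [Finite E] : K.barB1 ≤ K.barZ1 := by
  rintro _ ⟨φ, rfl⟩
  exact K.barD1_barD0 φ

/-- The first real cohomology of the closed complex, cocycles modulo coboundaries. -/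
abbrev BarH1 [Finite V] [Finite E] : Type _ := K.barZ1 ⧸ K.barB1.submoduleOf K.barZ1

/-- The family `g` of 1-cochains of `K` represents a basis of the first cohomology of the closed
complex: every `g i` vanishes on the boundary edges, so that it is a 1-cochain of the closed
complex, it is a cocycle there, and the cohomology classes of the `g i` form a basis, indexed
by `i`. -/
def RepresentsBasis [Finite V] [Finite E] {ι : Type*} (g : ι → E → ℝ) : Prop :=
  (∀ i, ∀ e ∈ K.boundaryEdges, g i e = 0) ∧
  ∃ hz : ∀ i, (fun e : K.BarEdge => g i e.1) ∈ K.barZ1,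
    ∃ b : Module.Basis ι ℝ K.BarH1,
      ∀ i, b i = (K.barB1.submoduleOf K.barZ1).mkQ ⟨fun e => g i e.1, hz i⟩

/-! ### The two trees -/

/-- The dual edge of `e` joins the faces `f` and `f'`. -/
def DualJoins (e : E) (f f' : F) : Prop := f ≠ f' ∧ K.IsSide e f ∧ K.IsSide e f'

/-- The graph on all faces formed by the dual edges of the edges in `S` (parallel dual edges are
merged). -/
def dualGraphOf (S : Set E) : SimpleGraph F where
  Adj f f' := ∃ e ∈ S, K.DualJoins e f f'
  symm := ⟨fun _ _ ⟨e, he, h⟩ => ⟨e, he, h.1.symm, h.2.2, h.2.1⟩⟩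
  loopless := ⟨fun _ ⟨_, _, h⟩ => h.1 rfl⟩

/-- The choice of the two trees. `T` is the edge set of a spanning tree of `K` that restricts to
a spanning tree on every boundary component (it is obtained by extending such trees). `S`
consists of non-boundary edges outside `T`, and the dual edges of `S` form a spanning tree on the
faces. -/
structure TreePair where
  T : Set E
  T_isTree : (K.graphOf T).IsTree
  T_noParallel : Set.InjOn (fun e => s(K.src e, K.tgt e)) T
  T_boundary : ∀ v w, K.boundaryGraph.Reachable v w →
    (K.graphOf (T ∩ K.boundaryEdges)).Reachable v w
  S : Set E
  S_subset : ∀ e ∈ S, e ∉ T ∧ e ∉ K.boundaryEdges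
  S_isTree : (K.dualGraphOf S).IsTree
  S_noParallel : ∀ e ∈ S, ∀ e' ∈ S, ∀ f f',
    K.DualJoins e f f' → K.DualJoins e' f f' → e = e'

/-! ### Paths in the dual graph and the cochains they carry -/

/-- A walk in the dual graph from face to face, with dual edges from `S`. -/
inductive DualWalk (S : Set E) : F → F → Type _
  | nil (f : F) : DualWalk S f f
  | cons {f f' f'' : F} (e : E) (he : e ∈ S) (h : K.DualJoins e f f')
      (p : DualWalk S f' f'') : DualWalk S f f''

namespace DualWalk

variable {K} {S : Set E}

/-- The faces visited by the walk. -/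
def faces : {f f' : F} → K.DualWalk S f f' → List F
  | _, _, nil f => [f]
  | f, _, cons _ _ _ p => f :: p.faces

/-- The edges crossed by the walk. -/
def edges : {f f' : F} → K.DualWalk S f f' → List E
  | _, _, nil _ => []
  | _, _, cons e _ _ p => e :: p.edges

/-- A path is a walk with distinct faces and distinct dual edges. -/
def IsPath {f f' : F} (p : K.DualWalk S f f') : Prop := p.faces.Nodup ∧ p.edges.Nodup

/-- The value that a cochain with value `c a` on the side `a` of `f` needs on the side `e` of `f`
for the two contributions to the coboundary on `f` to cancel. -/
def nextValue (K : TriComplex V E F) (f : F) (a e : E) (c : E → ℝ) : ℝ :=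
  -((K.inc f e : ℝ) / (K.inc f a : ℝ)) * c a

open scoped Classical in
/-- Starting from the cochain `c` and the edge `a`, run through the edges crossed by the walk and
assign to each of them the value determined by its predecessor. The result is the final cochain,
with the last edge reached. -/
def sweep : {f f' : F} → K.DualWalk S f f' → E → (E → ℝ) → (E → ℝ) × E
  | _, _, nil _, a, c => (c, a)
  | f, _, cons e _ _ p, a, c => p.sweep e (Function.update c e (nextValue K f a e c))

open scoped Classical in
/-- The cochain carried by a path `p` and a pair `(e, e')` of edges, `e` a side of the first face
and `e'` of the last one. It has the value `1` on `e`, the values on the edges crossed are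
determined one after the other, and so is finally the value on `e'`. When `e' = e` and the last
value contradicts the initial value `1`, the result is the zero cochain. -/
def cochain {f f' : F} (p : K.DualWalk S f f') (e e' : E) : E → ℝ :=
  let r := p.sweep e (Pi.single e 1)
  let z := nextValue K f' r.2 e' r.1
  if e' = e ∧ z ≠ 1 then 0 else Function.update r.1 e' z

end DualWalk

/-! ### The construction of the handle cochains -/

namespace TreePair

variable {K} (P : K.TreePair)

/-- The edges whose duals are in the completed dual tree: one adds to `S` the edges of the boundary
components that are not in `T`, each with a pendant dual node of its own. -/
def dualTreeEdges : Set E := P.S ∪ {e | e ∈ K.boundaryEdges ∧ e ∉ P.T}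

/-- The edges that are not in the tree and whose duals are not in the dual tree. -/
def EM : Set E := {e | e ∉ P.T ∧ e ∉ P.dualTreeEdges}

/-- The choices of the first loop: for every `e` in `EM` a labelling `face₁ e, face₂ e` of the two
faces at `e`, and the path in the dual tree from the first to the second. -/
structure FirstLoop where
  face₁ : P.EM → F
  face₂ : P.EM → F
  joins : ∀ e : P.EM, K.DualJoins e.1 (face₁ e) (face₂ e)
  path : ∀ e : P.EM, K.DualWalk P.S (face₁ e) (face₂ e)
  isPath : ∀ e, (path e).IsPath

variable {P}

/-- The cochain computed for `e` by the first loop. -/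
def FirstLoop.cochain (A : P.FirstLoop) (e : P.EM) : E → ℝ := (A.path e).cochain e.1 e.1

/-- The torsion edges: those for which the first loop returns the zero cochain. -/
def FirstLoop.EMII (A : P.FirstLoop) : Set P.EM := {e | A.cochain e = 0}

/-- The choices of the second loop, when `e₀` is the selected torsion edge: in the iteration for
`e`, a labelling `star₁ e, star₂ e` of the two faces at `e₀`, and the paths in the dual tree from
the first face at `e` to the first face at `e₀` and from the second to the second. Only those for
torsion edges `e ≠ e₀` are used. -/
structure FirstLoop.SecondLoop (A : P.FirstLoop) (e₀ : P.EM) where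
  star₁ : P.EM → F
  star₂ : P.EM → F
  joins : ∀ e, K.DualJoins e₀.1 (star₁ e) (star₂ e)
  path₁ : ∀ e, K.DualWalk P.S (A.face₁ e) (star₁ e)
  path₂ : ∀ e, K.DualWalk P.S (A.face₂ e) (star₂ e)
  isPath₁ : ∀ e, (path₁ e).IsPath
  isPath₂ : ∀ e, (path₂ e).IsPath

open scoped Classical in
/-- The cochain finally returned for `e ≠ e₀`: on torsion edges the one computed by the second
loop, otherwise the one computed by the first. -/
def FirstLoop.SecondLoop.cochain {A : P.FirstLoop} {e₀ : P.EM} (B : A.SecondLoop e₀) (e : P.EM) : E → ℝ :=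
  if e ∈ A.EMII then
    fun a =>
      if a = e.1 ∨ a = e₀.1 then (B.path₁ e).cochain e.1 e₀.1 a
      else (B.path₁ e).cochain e.1 e₀.1 a + (B.path₂ e).cochain e.1 e₀.1 a
  else A.cochain e

end TreePair

end TriComplex

end

/-!
Subtracting from a cocycle of the closed complex the coboundary that agrees with it on the tree
`T` shows that `H¹` is the space of 1-cocycles of the triangulation that vanish on `T` and on the
boundary. Such a cocycle is determined by its values on `EM`, since the incidence matrix is
injective on cochains supported on the dual tree `S`.

As `S` is a tree, the faces can be reoriented so that, for a cochain `c`, summing the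
coboundary of `c` over the faces cancels all terms from `S`. The coefficient of `c e` in this sum
is `0` or `±2` for `e ∈ EM`, and the path from one face at `e` to the other, closed up at `e`,
carries a cocycle precisely when it is `0`. If all coefficients vanish, these cocycles are dual to
the evaluations on `EM`. Otherwise the sum is one linear relation between the values on `EM`, which
determines the value on `e₀` from the others, and two torsion edges together carry a cocycle; the
cocycles obtained are dual to the evaluations on the edges of `EM` other than `e₀`.
-/

section TreeSystems

variable {X M I 𝕜 : Type*} {G : SimpleGraph X}

theorem eq_of_reachable {ψ : X → M} (h : ∀ v w, G.Adj v w → ψ v = ψ w) {v w : X}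
    (hvw : G.Reachable v w) : ψ v = ψ w := by
  obtain ⟨p⟩ := hvw
  induction p with
  | nil => rfl
  | cons hadj _ ih => exact (h _ _ hadj).trans ih

theorem exists_potential_of_isTree (hG : G.IsTree) (t : G.Dart → Equiv.Perm M)
    (ht : ∀ d, t d.symm = (t d)⁻¹) (r : X) (m₀ : M) :
    ∃ p : X → M, p r = m₀ ∧ ∀ d : G.Dart, p d.snd = t d (p d.fst) := by
  let transport {v w : X} (q : G.Walk v w) : M := q.darts.foldl (fun m d => t d m) m₀
  choose q hq hq_unique using hG.existsUnique_path r
  have transport_snd (d : G.Dart) (hd : d.fst ∈ (q d.snd).support) :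
      transport (q d.snd) = t d (transport (q d.fst)) := by
    rw [hG.isAcyclic.path_concat (hq _) (hq _) d.adj hd]
    simp [transport, SimpleGraph.Walk.darts_concat]
  refine ⟨fun v => transport (q v), ?_, fun d => ?_⟩
  · have q_root : q r = .nil := (hq_unique r .nil .nil).symm
    simp [transport, q_root]
  · by_cases hd : d.fst ∈ (q d.snd).support
    · exact transport_snd d hd
    · have hd' : d.snd ∈ (q d.fst).support :=
        hG.isAcyclic.mem_support_of_ne_mem_support_of_adj_of_isPath (hq _) (hq _) d.adj hd
      rw [← Equiv.Perm.inv_eq_iff_eq, ← ht]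
      exact (transport_snd d.symm hd').symm

theorem exists_linear_solution_of_isTree [Field 𝕜] {T : Set I} {a b : I → X}
    (htree : (SimpleGraph.fromEdgeSet ((fun i => s(a i, b i)) '' T)).IsTree)
    (hinj : T.InjOn fun i => s(a i, b i)) (hne : ∀ i ∈ T, a i ≠ b i) {k : X → I → 𝕜}
    (ha : ∀ i ∈ T, k (a i) i ≠ 0) (hb : ∀ i ∈ T, k (b i) i ≠ 0) (y : I → 𝕜) (r : X) (x₀ : 𝕜) :
    ∃ x : X → 𝕜, x r = x₀ ∧ ∀ i ∈ T, x (a i) * k (a i) i + x (b i) * k (b i) i = y i := by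
  set G := SimpleGraph.fromEdgeSet ((fun i => s(a i, b i)) '' T)
  have label_exists (d : G.Dart) : ∃ i ∈ T, s(a i, b i) = d.edge := by
    have := d.edge_mem
    rw [SimpleGraph.edgeSet_fromEdgeSet] at this
    exact this.1
  choose label hlabel hlabel_edge using label_exists
  have label_eq (d : G.Dart) {i : I} (hi : i ∈ T) (hd : s(a i, b i) = d.edge) : label d = i :=
    hinj (hlabel d) hi ((hlabel_edge d).trans hd.symm)
  have label_symm (d : G.Dart) : label d.symm = label d :=
    label_eq _ (hlabel d) ((hlabel_edge d).trans d.edge_symm.symm)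
  have coeff_ne_zero (d : G.Dart) : k d.fst (label d) ≠ 0 ∧ k d.snd (label d) ≠ 0 := by
    have ha := ha _ (hlabel d)
    have hb := hb _ (hlabel d)
    rcases Sym2.eq_iff.1 (hlabel_edge d) with ⟨h₁, h₂⟩ | ⟨h₁, h₂⟩ <;>
      rw [h₁] at ha <;> rw [h₂] at hb
    exacts [⟨ha, hb⟩, ⟨hb, ha⟩]
  let t (d : G.Dart) : Equiv.Perm 𝕜 :=
    { toFun m := (y (label d) - m * k d.fst (label d)) / k d.snd (label d)
      invFun m := (y (label d) - m * k d.snd (label d)) / k d.fst (label d)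
      left_inv m := by have := coeff_ne_zero d; field_simp [this.1, this.2]; ring
      right_inv m := by have := coeff_ne_zero d; field_simp [this.1, this.2]; ring }
  have t_symm (d : G.Dart) : t d.symm = (t d)⁻¹ := by
    ext m
    simp only [t, label_symm]
    rfl
  obtain ⟨x, hxr, hx⟩ := exists_potential_of_isTree htree t t_symm r x₀
  refine ⟨x, hxr, fun i hi => ?_⟩
  let d : G.Dart := ⟨(a i, b i), (SimpleGraph.fromEdgeSet_adj _).2 ⟨⟨i, hi, rfl⟩, hne i hi⟩⟩
  have hxd : x (b i) = (y (label d) - x (a i) * k (a i) (label d)) / k (b i) (label d) := hx d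
  rw [label_eq d hi rfl] at hxd
  rw [hxd, div_mul_cancel₀ _ (hb i hi), add_sub_cancel]

end TreeSystems

section LinearAlgebra

open Matrix

theorem exists_basis_of_dual {ι R M : Type*} [Finite ι] [DecidableEq ι] [Ring R] [AddCommGroup M]
    [Module R M] {φ : M →ₗ[R] ι → R} (hφ : Function.Injective φ) {g : ι → M}
    (hg : ∀ i, φ (g i) = Pi.single i 1) : ∃ b : Module.Basis ι R M, ∀ i, b i = g i := by
  have := Fintype.ofFinite ι
  have hφ_surj : Function.Surjective φ := fun v =>
    ⟨∑ i, v i • g i, by simp [hg, ← Pi.single_smul, Finset.univ_sum_single]⟩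
  refine ⟨.ofEquivFun (.ofBijective φ ⟨hφ, hφ_surj⟩), fun i => ?_⟩
  rw [Module.Basis.coe_ofEquivFun, LinearEquiv.symm_apply_eq]
  exact (hg i).symm

theorem dotProduct_mulVec_eq_mul {m n R : Type*} [Fintype m] [Fintype n] [NonUnitalSemiring R]
    {A : Matrix m n R} {x : m → R} {y : n → R} (j : n)
    (h : ∀ i ≠ j, (x ᵥ* A) i = 0 ∨ y i = 0) : x ⬝ᵥ A *ᵥ y = (x ᵥ* A) j * y j := by
  rw [dotProduct_mulVec]
  refine Finset.sum_eq_single j (fun i _ hi => ?_) (by simp)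
  rcases h i hi with h | h <;> simp [h]

end LinearAlgebra

namespace TriComplex

open Matrix

variable {V E F : Type*} {K : TriComplex V E F}

/-! ### Incidence numbers and dual edges -/

variable (K) in
/-- Every edge is a side of one or two faces. Unlike for a surface, the link of a node may be any
disjoint union of arcs and circles. -/
def IsPseudosurface : Prop :=
  ∀ e, {f | K.IsSide e f}.ncard = 1 ∨ {f | K.IsSide e f}.ncard = 2

theorem edge_injective (f : F) : Function.Injective (K.edge f) := by
  intro i j hij
  have hends := K.edge_ends f i
  rw [hij, K.edge_ends f j, Sym2.eq_iff] at hends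
  have hvert := K.vert_injective f
  rcases hends with ⟨h, -⟩ | ⟨h, h'⟩
  · exact (hvert h).symm
  · have cyclic : ∀ i j : Fin 3, j = i + 1 → j + 1 = i → i = j := by decide
    exact cyclic i j (hvert h) (hvert h')

theorem inc_sq {f : F} {e : E} (h : K.IsSide e f) : (K.inc f e : ℝ) ^ 2 = 1 := by
  classical
  obtain ⟨i, rfl⟩ := h
  have hinc : K.inc f (K.edge f i) = if K.src (K.edge f i) = K.vert f i then 1 else -1 := by
    simp [inc, (edge_injective f).eq_iff]
  rw [hinc]
  split_ifs <;> simp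

theorem inc_ne_zero {f : F} {e : E} (h : K.IsSide e f) : (K.inc f e : ℝ) ≠ 0 :=
  fun h0 => by simpa [h0] using inc_sq h

theorem inc_eq_zero {f : F} {e : E} (h : ¬ K.IsSide e f) : K.inc f e = 0 := by
  classical
  exact Finset.sum_eq_zero fun i _ => if_neg fun hi => h ⟨i, hi⟩

theorem DualJoins.symm {e : E} {f f' : F} (h : K.DualJoins e f f') : K.DualJoins e f' f :=
  ⟨h.1.symm, h.2.2, h.2.1⟩

theorem IsPseudosurface.exists_dualJoins (hK : K.IsPseudosurface) {e : E}
    (he : e ∉ K.boundaryEdges) : ∃ f f', K.DualJoins e f f' := by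
  obtain ⟨f, f', hne, hfaces⟩ := Set.ncard_eq_two.1 ((hK e).resolve_left he)
  have hside : ∀ g ∈ ({f, f'} : Set F), K.IsSide e g := fun g hg => hfaces.symm.subset hg
  exact ⟨f, f', hne, hside f (by simp), hside f' (by simp)⟩

theorem IsPseudosurface.isSide_iff (hK : K.IsPseudosurface) {e : E} {f f' g : F}
    (h : K.DualJoins e f f') : K.IsSide e g ↔ g = f ∨ g = f' := by
  refine ⟨fun hg => ?_, by rintro (rfl | rfl); exacts [h.2.1, h.2.2]⟩
  have hfaces : {f, f'} = {f | K.IsSide e f} := by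
    refine Set.eq_of_subset_of_ncard_le (Set.pair_subset h.2.1 h.2.2) ?_
      (Set.finite_of_ncard_pos ?_)
    · rw [Set.ncard_pair h.1]
      rcases hK e with h | h <;> omega
    · rcases hK e with h | h <;> omega
  exact hfaces.symm.subset hg

theorem IsPseudosurface.dualJoins_iff (hK : K.IsPseudosurface) {e : E} {f f' g g' : F}
    (h : K.DualJoins e f f') : K.DualJoins e g g' ↔ s(f, f') = s(g, g') := by
  constructor
  · rintro ⟨hne, hg, hg'⟩
    rcases (hK.isSide_iff h).1 hg with rfl | rfl <;>
      rcases (hK.isSide_iff h).1 hg' with rfl | rfl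
    exacts [(hne rfl).elim, rfl, Sym2.eq_swap, (hne rfl).elim]
  · intro hs
    rcases Sym2.eq_iff.1 hs with ⟨rfl, rfl⟩ | ⟨rfl, rfl⟩
    exacts [h, h.symm]

/-! ### The incidence matrix -/

variable (K) in
/-- The real incidence matrix of faces and edges: `K.incMatrix *ᵥ c` is the coboundary of the
1-cochain `c` of `K`, and `x ᵥ* K.incMatrix` is the boundary of the 2-chain `x`. -/
noncomputable def incMatrix : Matrix F E ℝ := .of fun f e => (K.inc f e : ℝ)

theorem incMatrix_mulVec_single [Fintype E] [DecidableEq E] [DecidableEq F]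
    (hK : K.IsPseudosurface) {e : E} {f f' : F} (h : K.DualJoins e f f') (x : ℝ) :
    K.incMatrix *ᵥ Pi.single e x =
      Pi.single f (K.inc f e * x) + Pi.single f' (K.inc f' e * x) := by
  funext g
  have hcol : (K.incMatrix *ᵥ Pi.single e x) g = K.inc g e * x := by
    simp [Matrix.mulVec_single, incMatrix]
  rw [hcol, Pi.add_apply]
  by_cases hg : K.IsSide e g
  · rcases (hK.isSide_iff h).1 hg with rfl | rfl
    · simp [h.1]
    · simp [h.1.symm]
  · obtain ⟨hgf, hgf'⟩ := not_or.1 (mt (hK.isSide_iff h).2 hg)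
    simp [inc_eq_zero hg, hgf, hgf']

theorem vecMul_incMatrix_apply [Fintype F] (hK : K.IsPseudosurface) {e : E} {f f' : F}
    (h : K.DualJoins e f f') (x : F → ℝ) :
    (x ᵥ* K.incMatrix) e = x f * K.inc f e + x f' * K.inc f' e := by
  refine Fintype.sum_eq_add f f' h.1 fun g hg => ?_
  have hside : ¬ K.IsSide e g := by simpa [hK.isSide_iff h] using hg
  simp [incMatrix, inc_eq_zero hside]

theorem barD1_restrict [Fintype E] {c : E → ℝ} (hc : ∀ e ∈ K.boundaryEdges, c e = 0) :
    K.barD1 (fun e => c e.1) = K.incMatrix *ᵥ c := by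
  funext f
  refine Fintype.sum_of_injective (fun e : K.BarEdge => e.1) Subtype.val_injective _ _
    (fun e he => ?_) fun _ => rfl
  have he_bd : e ∈ K.boundaryEdges := by_contra fun h => he ⟨⟨e, h⟩, rfl⟩
  simp [hc e he_bd]

/-! ### Signs of the faces along the dual tree -/

/-- Signs of the faces, that is, a choice of new orientations, such that the two faces at each
edge of `S` induce opposite orientations on it. -/
structure IsSigning [Fintype F] (K : TriComplex V E F) (S : Set E) (σ : F → ℝ) : Prop where
  sq_eq_one : ∀ f, σ f ^ 2 = 1
  vecMul_eq_zero : ∀ e ∈ S, (σ ᵥ* K.incMatrix) e = 0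

namespace IsSigning

variable [Fintype F] {S : Set E} {σ : F → ℝ}

theorem mul_inc_ne_zero (hσ : K.IsSigning S σ) {e : E} {f : F} (h : K.IsSide e f) :
    σ f * K.inc f e ≠ 0 :=
  mul_ne_zero (fun h0 => by simpa [h0] using hσ.sq_eq_one f) (inc_ne_zero h)

theorem vecMul_ne_zero_iff (hσ : K.IsSigning S σ) (hK : K.IsPseudosurface) {e : E} {f f' : F}
    (h : K.DualJoins e f f') :
    (σ ᵥ* K.incMatrix) e ≠ 0 ↔ σ f * K.inc f e = σ f' * K.inc f' e := by
  have hsq : (σ f * K.inc f e) ^ 2 = (σ f' * K.inc f' e) ^ 2 := by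
    simp only [mul_pow, hσ.sq_eq_one, inc_sq h.2.1, inc_sq h.2.2]
  rw [vecMul_incMatrix_apply hK h]
  refine ⟨fun hne => ?_, fun heq => ?_⟩
  · exact (eq_or_eq_neg_of_sq_eq_sq _ _ hsq).resolve_right fun h => hne (by rw [h, neg_add_cancel])
  · rw [heq, ← two_mul]
    exact mul_ne_zero two_ne_zero (hσ.mul_inc_ne_zero h.2.2)

end IsSigning

namespace TreePair

variable (P : K.TreePair)

theorem exists_vecMul_incMatrix_eq [Fintype F] (hK : K.IsPseudosurface) (y : E → ℝ) (r : F)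
    (x₀ : ℝ) : ∃ x : F → ℝ, x r = x₀ ∧ ∀ e ∈ P.S, (x ᵥ* K.incMatrix) e = y e := by
  have : Nonempty F := ⟨r⟩
  choose! a b hab using fun e (he : e ∈ P.S) => hK.exists_dualJoins (P.S_subset e he).2
  have hgraph : K.dualGraphOf P.S =
      SimpleGraph.fromEdgeSet ((fun e => s(a e, b e)) '' P.S) := by
    ext f f'
    rw [SimpleGraph.fromEdgeSet_adj]
    constructor
    · rintro ⟨e, he, h⟩
      exact ⟨⟨e, he, (hK.dualJoins_iff (hab e he)).1 h⟩, h.1⟩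
    · rintro ⟨⟨e, he, h⟩, -⟩
      exact ⟨e, he, (hK.dualJoins_iff (hab e he)).2 h⟩
  have hinj : P.S.InjOn fun e => s(a e, b e) := fun e he e' he' h =>
    P.S_noParallel e he e' he' _ _ (hab e he) ((hK.dualJoins_iff (hab e' he')).2 h.symm)
  obtain ⟨x, hxr, hx⟩ := exists_linear_solution_of_isTree (hgraph ▸ P.S_isTree) hinj
    (fun e he => (hab e he).1) (k := K.incMatrix) (fun e he => inc_ne_zero (hab e he).2.1)
    (fun e he => inc_ne_zero (hab e he).2.2) y r x₀
  exact ⟨x, hxr, fun e he => (vecMul_incMatrix_apply hK (hab e he) x).trans (hx e he)⟩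

theorem eq_zero_of_incMatrix_mulVec_eq_zero [Fintype E] [Finite F] (hK : K.IsPseudosurface)
    {c : E → ℝ} (hc : ∀ e ∉ P.S, c e = 0) (hcocycle : K.incMatrix *ᵥ c = 0) : c = 0 := by
  classical
  have := Fintype.ofFinite F
  funext e
  by_cases he : e ∈ P.S
  · obtain ⟨r⟩ := P.S_isTree.connected.nonempty
    obtain ⟨x, -, hx⟩ := P.exists_vecMul_incMatrix_eq hK (Pi.single e 1) r 0
    have hpair : x ⬝ᵥ K.incMatrix *ᵥ c = (x ᵥ* K.incMatrix) e * c e :=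
      dotProduct_mulVec_eq_mul e fun e' hne =>
        (em (e' ∈ P.S)).imp (fun h => by rw [hx e' h, Pi.single_eq_of_ne hne]) (hc e')
    simpa [hcocycle, hx e he] using hpair.symm
  · exact hc e he

theorem exists_isSigning [Fintype F] (hK : K.IsPseudosurface) :
    ∃ σ : F → ℝ, K.IsSigning P.S σ := by
  obtain ⟨r⟩ := P.S_isTree.connected.nonempty
  obtain ⟨σ, hσr, hσ⟩ := P.exists_vecMul_incMatrix_eq hK 0 r 1
  have hsq_adj (f f' : F) (hadj : (K.dualGraphOf P.S).Adj f f') : σ f ^ 2 = σ f' ^ 2 := by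
    obtain ⟨e, he, h⟩ := hadj
    have hopp : σ f * K.inc f e = -(σ f' * K.inc f' e) :=
      eq_neg_of_add_eq_zero_left ((vecMul_incMatrix_apply hK h σ).symm.trans (hσ e he))
    have hsq : (σ f * K.inc f e) ^ 2 = (σ f' * K.inc f' e) ^ 2 := by rw [hopp, neg_sq]
    simpa only [mul_pow, inc_sq h.2.1, inc_sq h.2.2, mul_one] using hsq
  refine ⟨σ, fun f => ?_, hσ⟩
  rw [eq_of_reachable (ψ := fun f => σ f ^ 2) hsq_adj (P.S_isTree.connected f r), hσr, one_pow]

end TreePair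

/-! ### Cohomology as cocycles vanishing on the tree and the boundary -/

theorem barD0_apply [Finite V] (φ : K.BarNode → ℝ) (e : K.BarEdge) :
    K.barD0 φ e = φ (K.toBarNode (K.tgt e.1)) - φ (K.toBarNode (K.src e.1)) := by
  classical
  simp [barD0, barIncEdge, sub_mul, Finset.sum_sub_distrib]

theorem toBarNode_src_eq {e : E} (he : e ∈ K.boundaryEdges) :
    K.toBarNode (K.src e) = K.toBarNode (K.tgt e) := by
  have hadj : K.boundaryGraph.Adj (K.src e) (K.tgt e) :=
    (SimpleGraph.fromEdgeSet_adj _).2 ⟨⟨e, he, rfl⟩, K.src_ne_tgt e⟩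
  exact SimpleGraph.ConnectedComponent.sound hadj.reachable

theorem eq_of_reachable_graphOf {T : Set E} {M : Type*} {ψ : V → M}
    (h : ∀ e ∈ T, ψ (K.src e) = ψ (K.tgt e)) {v w : V} (hvw : (K.graphOf T).Reachable v w) :
    ψ v = ψ w := by
  refine eq_of_reachable (fun v w hadj => ?_) hvw
  obtain ⟨⟨e, he, hends⟩, -⟩ := (SimpleGraph.fromEdgeSet_adj _).1 hadj
  rcases Sym2.eq_iff.1 hends with ⟨rfl, rfl⟩ | ⟨rfl, rfl⟩
  exacts [h e he, (h e he).symm]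

namespace TreePair

variable (P : K.TreePair)

theorem barD0_eq_zero [Finite V] {φ : K.BarNode → ℝ}
    (h : ∀ e : K.BarEdge, e.1 ∈ P.T → K.barD0 φ e = 0) : K.barD0 φ = 0 := by
  funext e
  rw [barD0_apply, Pi.zero_apply, sub_eq_zero]
  refine eq_of_reachable_graphOf (ψ := fun v => φ (K.toBarNode v)) (fun e he => ?_)
    (P.T_isTree.connected _ _)
  by_cases hb : e ∈ K.boundaryEdges
  · simp only [toBarNode_src_eq hb]
  · exact (sub_eq_zero.1 ((barD0_apply φ ⟨e, hb⟩).symm.trans (h ⟨e, hb⟩ he))).symm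

theorem exists_barD0_eq [Finite V] (c : K.BarEdge → ℝ) :
    ∃ φ : K.BarNode → ℝ, ∀ e : K.BarEdge, e.1 ∈ P.T → K.barD0 φ e = c e := by
  classical
  obtain ⟨r⟩ := P.T_isTree.connected.nonempty
  let c₀ : E → ℝ := Function.extend (fun e : K.BarEdge => e.1) c 0
  obtain ⟨ψ, -, hψ⟩ := exists_linear_solution_of_isTree P.T_isTree P.T_noParallel
    (fun e _ => K.src_ne_tgt e) (k := fun v e => if v = K.tgt e then (1 : ℝ) else -1)
    (fun e _ => by simp [K.src_ne_tgt e]) (fun e _ => by simp) c₀ r 0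
  have hψT : ∀ e ∈ P.T, ψ (K.tgt e) - ψ (K.src e) = c₀ e := fun e he => by
    rw [← hψ e he, if_neg (K.src_ne_tgt e), if_pos rfl]
    ring
  have hψ_const : ∀ v w, K.boundaryGraph.Reachable v w → ψ v = ψ w := fun v w hvw => by
    refine eq_of_reachable_graphOf (fun e he => ?_) (P.T_boundary v w hvw)
    have hc₀ : c₀ e = 0 := Function.extend_apply' _ _ _ fun ⟨a, ha⟩ => a.2 (ha ▸ he.2)
    exact (sub_eq_zero.1 ((hψT e he.1).trans hc₀)).symm
  let φ : K.BarNode → ℝ :=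
    SimpleGraph.ConnectedComponent.lift ψ fun v w p _ => hψ_const v w p.reachable
  refine ⟨φ, fun e he => (barD0_apply φ e).trans ?_⟩
  exact (hψT e.1 he).trans (Subtype.val_injective.extend_apply c 0 e)

/-- The 1-cocycles of `K` relative to the tree `T` and the boundary. -/
noncomputable def relCocycles [Fintype E] : Submodule ℝ (E → ℝ) :=
  LinearMap.ker K.incMatrix.mulVecLin ⊓ Submodule.pi (K.boundaryEdges ∪ P.T) fun _ => ⊥

variable {P}

theorem mem_relCocycles [Fintype E] {c : E → ℝ} :
    c ∈ P.relCocycles ↔ K.incMatrix *ᵥ c = 0 ∧ ∀ e ∈ K.boundaryEdges ∪ P.T, c e = 0 := by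
  simp [relCocycles, Submodule.mem_pi]

theorem restrict_mem_barZ1 [Fintype E] {c : E → ℝ} (hc : c ∈ P.relCocycles) :
    (fun e : K.BarEdge => c e.1) ∈ K.barZ1 := by
  obtain ⟨hcocycle, hc⟩ := mem_relCocycles.1 hc
  exact (barD1_restrict fun e he => hc e (Or.inl he)).trans hcocycle

variable (P) in
/-- The cohomology class in the closed complex of a 1-cocycle of `K` relative to the tree and the
boundary. -/
noncomputable def relCocyclesToBarH1 [Finite V] [Fintype E] : P.relCocycles →ₗ[ℝ] K.BarH1 :=
  (K.barB1.submoduleOf K.barZ1).mkQ ∘ₗ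
    (LinearMap.funLeft ℝ ℝ fun e : K.BarEdge => e.1).restrict fun _ => restrict_mem_barZ1

theorem relCocyclesToBarH1_injective [Finite V] [Fintype E] :
    Function.Injective P.relCocyclesToBarH1 := by
  rw [injective_iff_map_eq_zero]
  rintro ⟨c, hc⟩ hclass
  have hc_zero := (mem_relCocycles.1 hc).2
  obtain ⟨φ, hφ⟩ : (fun e : K.BarEdge => c e.1) ∈ K.barB1 :=
    (Submodule.Quotient.mk_eq_zero (K.barB1.submoduleOf K.barZ1)).1 hclass
  have hφ_zero : K.barD0 φ = 0 :=
    P.barD0_eq_zero fun e he => (congrFun hφ e).trans (hc_zero e.1 (Or.inr he))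
  ext e
  by_cases he : e ∈ K.boundaryEdges
  · exact hc_zero e (Or.inl he)
  · exact (congrFun (hφ.symm.trans hφ_zero) ⟨e, he⟩ :)

theorem relCocyclesToBarH1_surjective [Finite V] [Fintype E] :
    Function.Surjective P.relCocyclesToBarH1 := by
  intro q
  obtain ⟨⟨z, hz⟩, rfl⟩ := Submodule.mkQ_surjective _ q
  obtain ⟨φ, hφ⟩ := P.exists_barD0_eq z
  let c : E → ℝ := Function.extend (fun e : K.BarEdge => e.1) (z - K.barD0 φ) 0
  have hc_bar : (fun e : K.BarEdge => c e.1) = z - K.barD0 φ :=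
    funext fun e => Subtype.val_injective.extend_apply _ _ e
  have hc_bd : ∀ e ∈ K.boundaryEdges, c e = 0 := fun e he =>
    Function.extend_apply' _ _ _ fun ⟨a, ha⟩ => a.2 (ha ▸ he)
  have hc : c ∈ P.relCocycles := by
    refine mem_relCocycles.2 ⟨?_, fun e he => ?_⟩
    · rw [← barD1_restrict hc_bd, hc_bar]
      exact K.barZ1.sub_mem hz (K.barD1_barD0 φ)
    · by_cases hb : e ∈ K.boundaryEdges
      · exact hc_bd e hb
      · exact (congrFun hc_bar ⟨e, hb⟩).trans
          (sub_eq_zero.2 (hφ ⟨e, hb⟩ (he.resolve_left hb)).symm)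
  have hdiff : z - (fun e : K.BarEdge => c e.1) ∈ K.barB1 :=
    ⟨φ, by rw [hc_bar, sub_sub_cancel]⟩
  exact ⟨⟨c, hc⟩, ((Submodule.Quotient.eq (K.barB1.submoduleOf K.barZ1)).2 hdiff).symm⟩

theorem representsBasis_of_dual [Finite V] [Fintype E] {ι : Type*} [Finite ι] {g : ι → E → ℝ}
    {j : ι → E} (hg : ∀ i, g i ∈ P.relCocycles) (hdiag : ∀ i, g i (j i) = 1)
    (hoff : ∀ i i', i ≠ i' → g i (j i') = 0)
    (hinj : ∀ c ∈ P.relCocycles, (∀ i, c (j i) = 0) → c = 0) : K.RepresentsBasis g := by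
  classical
  have heval_inj : Function.Injective (LinearMap.funLeft ℝ ℝ j ∘ₗ P.relCocycles.subtype) := by
    rw [injective_iff_map_eq_zero]
    exact fun c hc => Subtype.ext (hinj c.1 c.2 (congrFun hc))
  have hdual (i : ι) : (LinearMap.funLeft ℝ ℝ j ∘ₗ P.relCocycles.subtype) ⟨g i, hg i⟩ =
      Pi.single i 1 := by
    funext i'
    rcases eq_or_ne i i' with rfl | hne
    · simpa using hdiag i
    · simpa [hne] using hoff i i' hne
  obtain ⟨b, hb⟩ := exists_basis_of_dual heval_inj hdual
  refine ⟨fun i e he => (mem_relCocycles.1 (hg i)).2 e (Or.inl he),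
    fun i => restrict_mem_barZ1 (hg i),
    b.map (.ofBijective _ ⟨P.relCocyclesToBarH1_injective, P.relCocyclesToBarH1_surjective⟩),
    fun i => ?_⟩
  rw [Module.Basis.map_apply, hb]
  rfl

/-! ### Relative cocycles are determined by their values on `EM` -/

theorem notMem_S_of_mem_EM {e : E} (he : e ∈ P.EM) : e ∉ P.S := fun h => he.2 (Or.inl h)

theorem compl_S_union_EM : (P.S ∪ P.EM)ᶜ = K.boundaryEdges ∪ P.T := by
  ext e
  have := P.S_subset e
  simp only [EM, dualTreeEdges, Set.mem_compl_iff, Set.mem_union, Set.mem_ofPred_eq]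
  tauto

theorem mem_relCocycles_iff_support [Fintype E] {c : E → ℝ} :
    c ∈ P.relCocycles ↔ K.incMatrix *ᵥ c = 0 ∧ ∀ e ∉ P.S, e ∉ P.EM → c e = 0 := by
  simp [mem_relCocycles, ← compl_S_union_EM]

theorem eq_zero_of_mem_relCocycles [Fintype E] [Finite F] (hK : K.IsPseudosurface) {c : E → ℝ}
    (hc : c ∈ P.relCocycles) (hEM : ∀ e ∈ P.EM, c e = 0) : c = 0 := by
  obtain ⟨hcocycle, hsupp⟩ := mem_relCocycles_iff_support.1 hc
  exact P.eq_zero_of_incMatrix_mulVec_eq_zero hK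
    (fun e he => (em (e ∈ P.EM)).elim (hEM e) (hsupp e he)) hcocycle

theorem eq_zero_of_mem_relCocycles_of_isSigning [Fintype E] [Fintype F]
    (hK : K.IsPseudosurface) {σ : F → ℝ} (hσ : K.IsSigning P.S σ) {e₀ : E}
    (he₀ : (σ ᵥ* K.incMatrix) e₀ ≠ 0) {c : E → ℝ} (hc : c ∈ P.relCocycles)
    (hEM : ∀ e ∈ P.EM, e ≠ e₀ → c e = 0) : c = 0 := by
  obtain ⟨hcocycle, hsupp⟩ := mem_relCocycles_iff_support.1 hc
  have hpair : σ ⬝ᵥ K.incMatrix *ᵥ c = (σ ᵥ* K.incMatrix) e₀ * c e₀ :=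
    dotProduct_mulVec_eq_mul e₀ fun e hne => (em (e ∈ P.S)).imp (hσ.vecMul_eq_zero e)
      fun hS => (em (e ∈ P.EM)).elim (hEM e · hne) (hsupp e hS)
  have hce₀ : c e₀ = 0 := by simpa [hcocycle, he₀] using hpair
  refine eq_zero_of_mem_relCocycles hK hc fun e he => ?_
  rcases eq_or_ne e e₀ with rfl | hne
  exacts [hce₀, hEM e he hne]

end TreePair

/-! ### The cochain of a path -/

namespace DualWalk

variable {S : Set E} {f f' f₂ : F} {e e' : E}

theorem mem_of_mem_edges (p : K.DualWalk S f f') (he : e ∈ p.edges) : e ∈ S := by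
  induction p with
  | nil => simp [edges] at he
  | cons e₁ he₁ _ p ih =>
    rcases List.mem_cons.1 he with rfl | he
    exacts [he₁, ih he]

theorem inc_mul_nextValue (he : K.IsSide e f) (he' : K.IsSide e' f) (c : E → ℝ) :
    K.inc f e' * nextValue K f e e' c = -(K.inc f e * c e) := by
  have hinc := inc_ne_zero he
  rw [nextValue]
  field_simp
  rw [inc_sq he, inc_sq he']

theorem isSide_sweep_snd (p : K.DualWalk S f f') (he : K.IsSide e f) (c : E → ℝ) :
    K.IsSide (p.sweep e c).2 f' := by
  induction p generalizing e c with
  | nil => exact he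
  | cons _ _ h _ ih => exact ih h.2.2 _

theorem sweep_fst_apply_of_notMem_edges (p : K.DualWalk S f f') (e : E) (c : E → ℝ) {x : E}
    (hx : x ∉ p.edges) : (p.sweep e c).1 x = c x := by
  classical
  induction p generalizing e c with
  | nil => rfl
  | cons _ _ _ _ ih =>
    rw [edges, List.mem_cons, not_or] at hx
    exact (ih _ _ hx.2).trans (Function.update_of_ne hx.1 _ _)

open scoped Classical in
theorem incMatrix_mulVec_sweep_fst [Fintype E] (hK : K.IsPseudosurface) (p : K.DualWalk S f f')
    (hp : p.edges.Nodup) (he : K.IsSide e f) {c : E → ℝ} (hc : ∀ x ∈ p.edges, c x = 0) :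
    K.incMatrix *ᵥ (p.sweep e c).1 = K.incMatrix *ᵥ c - Pi.single f (K.inc f e * c e) +
      Pi.single f' (K.inc f' (p.sweep e c).2 * (p.sweep e c).1 (p.sweep e c).2) := by
  induction p generalizing e c with
  | nil => exact (sub_add_cancel _ _).symm
  | @cons f f₁ f' e₁ _ h p ih =>
    rw [edges, List.nodup_cons] at hp
    have hc₁ : c e₁ = 0 := hc e₁ List.mem_cons_self
    set v := nextValue K f e e₁ c with hv
    have hupdate : Function.update c e₁ v = c + Pi.single e₁ v := by
      rw [Pi.update_eq_sub_add_single, hc₁, Pi.single_zero, sub_zero]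
    have hzero : ∀ x ∈ p.edges, Function.update c e₁ v x = 0 := fun x hx => by
      rw [Function.update_of_ne (ne_of_mem_of_not_mem hx hp.1)]
      exact hc x (List.mem_cons_of_mem _ hx)
    refine (ih hp.2 h.2.2 hzero).trans ?_
    rw [Function.update_self, hupdate, Matrix.mulVec_add, incMatrix_mulVec_single hK h, hv,
      inc_mul_nextValue he h.2.1, Pi.single_neg, ← hv, ← hupdate, sweep]
    abel

open scoped Classical in
/-- The cochain of a path with a free end: it has the values `a₀ = 1, a₁, …, a_{l-1}` on the edge
`e` and the edges crossed, and no value is assigned yet to an edge at the end of the path. -/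
noncomputable def openCochain (p : K.DualWalk S f f') (e : E) : E → ℝ :=
  (p.sweep e (Pi.single e 1)).1

open scoped Classical in
/-- The last value `a_l` of the cochain of the path `p` and the pair `(e, e')`: the one that the
edge `e'` needs for the coboundary to vanish on the last face. -/
noncomputable def endValue (p : K.DualWalk S f f') (e e' : E) : ℝ :=
  nextValue K f' (p.sweep e (Pi.single e 1)).2 e' (p.openCochain e)

open scoped Classical in
theorem openCochain_apply_of_notMem (p : K.DualWalk S f f') (e : E) {x : E} (hx : x ∉ S) :
    p.openCochain e x = (Pi.single e 1 : E → ℝ) x :=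
  p.sweep_fst_apply_of_notMem_edges e _ fun h => hx (p.mem_of_mem_edges h)

theorem openCochain_self (p : K.DualWalk S f f') (he : e ∉ S) : p.openCochain e e = 1 := by
  classical
  rw [p.openCochain_apply_of_notMem e he, Pi.single_eq_same]

open scoped Classical in
theorem incMatrix_mulVec_openCochain [Fintype E] (hK : K.IsPseudosurface)
    (p : K.DualWalk S f f') (hp : p.edges.Nodup) (h : K.DualJoins e f f₂) (heS : e ∉ S)
    (he' : K.IsSide e' f') : K.incMatrix *ᵥ p.openCochain e =
      Pi.single f₂ (K.inc f₂ e : ℝ) - Pi.single f' (K.inc f' e' * p.endValue e e') := by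
  have hzero : ∀ x ∈ p.edges, (Pi.single e 1 : E → ℝ) x = 0 := fun x hx =>
    Pi.single_eq_of_ne (ne_of_mem_of_not_mem (p.mem_of_mem_edges hx) heS) _
  rw [endValue, inc_mul_nextValue (p.isSide_sweep_snd h.2.1 _) he', Pi.single_neg,
    sub_neg_eq_add, openCochain, p.incMatrix_mulVec_sweep_fst hK hp h.2.1 hzero,
    incMatrix_mulVec_single hK h, Pi.single_eq_same, mul_one, mul_one, add_sub_cancel_left]

theorem mul_endValue_eq_neg [Finite E] [Fintype F] (hK : K.IsPseudosurface) {σ : F → ℝ}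
    (hσ : K.IsSigning S σ) (p : K.DualWalk S f f') (hp : p.edges.Nodup)
    (h : K.DualJoins e f f₂) (heS : e ∉ S) (he' : K.IsSide e' f') :
    σ f' * K.inc f' e' * p.endValue e e' = -(σ f * K.inc f e) := by
  classical
  have := Fintype.ofFinite E
  have hpair : σ ⬝ᵥ K.incMatrix *ᵥ p.openCochain e =
      (σ ᵥ* K.incMatrix) e * p.openCochain e e :=
    dotProduct_mulVec_eq_mul e fun x hne => (em (x ∈ S)).imp (hσ.vecMul_eq_zero x)
      fun hx => by rw [p.openCochain_apply_of_notMem e hx, Pi.single_eq_of_ne hne]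
  rw [p.incMatrix_mulVec_openCochain hK hp h heS he', p.openCochain_self heS,
    vecMul_incMatrix_apply hK h, dotProduct_sub, dotProduct_single, dotProduct_single] at hpair
  linarith

theorem endValue_self_eq_one_iff [Finite E] [Fintype F] (hK : K.IsPseudosurface) {σ : F → ℝ}
    (hσ : K.IsSigning S σ) (p : K.DualWalk S f f') (hp : p.edges.Nodup)
    (h : K.DualJoins e f f') (heS : e ∉ S) :
    p.endValue e e = 1 ↔ (σ ᵥ* K.incMatrix) e = 0 := by
  rw [vecMul_incMatrix_apply hK h, add_eq_zero_iff_neg_eq,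
    ← p.mul_endValue_eq_neg hK hσ hp h heS h.2.2, mul_eq_left₀ (hσ.mul_inc_ne_zero h.2.2)]

theorem cochain_self_of_endValue_eq_one (p : K.DualWalk S f f') (heS : e ∉ S)
    (hv : p.endValue e e = 1) : p.cochain e e = p.openCochain e := by
  classical
  have hcochain : p.cochain e e = Function.update (p.openCochain e) e (p.endValue e e) :=
    if_neg fun h => h.2 hv
  rw [hcochain, hv, ← p.openCochain_self heS, Function.update_eq_self]

theorem cochain_self_eq_zero_iff (p : K.DualWalk S f f') (heS : e ∉ S) :
    p.cochain e e = 0 ↔ p.endValue e e ≠ 1 := by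
  refine ⟨fun h0 hv => ?_, fun hv => if_pos ⟨rfl, hv⟩⟩
  have hone := p.openCochain_self heS
  rw [← p.cochain_self_of_endValue_eq_one heS hv, h0] at hone
  exact zero_ne_one hone

open scoped Classical in
theorem cochain_of_ne (p : K.DualWalk S f f') (hne : e' ≠ e) (heS' : e' ∉ S) :
    p.cochain e e' = p.openCochain e + Pi.single e' (p.endValue e e') := by
  have hcochain : p.cochain e e' = Function.update (p.openCochain e) e' (p.endValue e e') :=
    if_neg fun h => hne h.1
  have hzero : p.openCochain e e' = 0 := by
    rw [p.openCochain_apply_of_notMem e heS', Pi.single_eq_of_ne hne]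
  rw [hcochain, Pi.update_eq_sub_add_single, hzero, Pi.single_zero, sub_zero]

end DualWalk

/-! ### The handle cochains -/

namespace TreePair

variable {P : K.TreePair}

namespace FirstLoop

variable {A : P.FirstLoop} {e e₀ : P.EM}

theorem notMem_EMII_iff : e ∉ A.EMII ↔ (A.path e).endValue e e = 1 :=
  (not_congr ((A.path e).cochain_self_eq_zero_iff (notMem_S_of_mem_EM e.2))).trans not_not

theorem mem_EMII_iff [Finite E] [Fintype F] (hK : K.IsPseudosurface) {σ : F → ℝ}
    (hσ : K.IsSigning P.S σ) : e ∈ A.EMII ↔ (σ ᵥ* K.incMatrix) e ≠ 0 := by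
  rw [← not_iff_not, notMem_EMII_iff, not_not]
  exact (A.path e).endValue_self_eq_one_iff hK hσ (A.isPath e).2 (A.joins e)
    (notMem_S_of_mem_EM e.2)

theorem cochain_eq_openCochain (he : e ∉ A.EMII) :
    A.cochain e = (A.path e).openCochain e :=
  (A.path e).cochain_self_of_endValue_eq_one (notMem_S_of_mem_EM e.2) (notMem_EMII_iff.1 he)

theorem incMatrix_mulVec_cochain [Fintype E] (hK : K.IsPseudosurface) (he : e ∉ A.EMII) :
    K.incMatrix *ᵥ A.cochain e = 0 := by
  classical
  rw [cochain_eq_openCochain he, (A.path e).incMatrix_mulVec_openCochain hK (A.isPath e).2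
    (A.joins e) (notMem_S_of_mem_EM e.2) (A.joins e).2.2, notMem_EMII_iff.1 he, mul_one,
    sub_self]

open scoped Classical in
theorem cochain_apply_of_notMem (he : e ∉ A.EMII) {x : E} (hx : x ∉ P.S) :
    A.cochain e x = (Pi.single e.1 1 : E → ℝ) x := by
  rw [cochain_eq_openCochain he, (A.path e).openCochain_apply_of_notMem e hx]

theorem cochain_mem_relCocycles [Fintype E] (hK : K.IsPseudosurface) (he : e ∉ A.EMII) :
    A.cochain e ∈ P.relCocycles := by
  classical
  refine mem_relCocycles_iff_support.2
    ⟨incMatrix_mulVec_cochain hK he, fun x hx hxM => ?_⟩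
  rw [cochain_apply_of_notMem he hx, Pi.single_eq_of_ne (ne_of_mem_of_not_mem e.2 hxM).symm]

theorem representsBasis_cochain [Finite V] [Finite E] [Finite F] (hK : K.IsPseudosurface)
    (hA : A.EMII = ∅) : K.RepresentsBasis A.cochain := by
  classical
  have := Fintype.ofFinite E
  have hA' (e : P.EM) : e ∉ A.EMII := hA ▸ Set.notMem_empty e
  have happly (e e' : P.EM) : A.cochain e e' = (Pi.single e.1 1 : E → ℝ) e' :=
    cochain_apply_of_notMem (hA' e) (notMem_S_of_mem_EM e'.2)
  refine representsBasis_of_dual (j := Subtype.val) (fun e => cochain_mem_relCocycles hK (hA' e))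
    (fun e => ?_) (fun e e' hne => ?_) fun c hc hEM =>
      eq_zero_of_mem_relCocycles hK hc fun e he => hEM ⟨e, he⟩
  · rw [happly, Pi.single_eq_same]
  · rw [happly, Pi.single_eq_of_ne (Subtype.coe_ne_coe.2 hne.symm)]

namespace SecondLoop

variable {B : A.SecondLoop e₀}

theorem cochain_of_notMem_EMII (he : e ∉ A.EMII) : B.cochain e = A.cochain e := if_neg he

open scoped Classical in
theorem cochain_of_mem_EMII (he : e ∈ A.EMII) (hne : e ≠ e₀) :
    B.cochain e = (B.path₁ e).openCochain e + (B.path₂ e).openCochain e - Pi.single e.1 1 +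
      Pi.single e₀.1 ((B.path₁ e).endValue e e₀) := by
  have hne' : e₀.1 ≠ e.1 := Subtype.coe_ne_coe.2 hne.symm
  have heS := notMem_S_of_mem_EM e.2
  have heS₀ := notMem_S_of_mem_EM e₀.2
  have hopen₁ := (B.path₁ e).openCochain_apply_of_notMem e.1 heS₀
  have hopen₂ := (B.path₂ e).openCochain_apply_of_notMem e.1 heS₀
  funext x
  simp only [cochain, if_pos he, DualWalk.cochain_of_ne _ hne' heS₀, Pi.add_apply, Pi.sub_apply]
  rcases eq_or_ne x e with rfl | hxe
  · simp [DualWalk.openCochain_self _ heS, hne'.symm]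
  rcases eq_or_ne x e₀ with rfl | hxe₀
  · simp [hopen₁, hopen₂, hne']
  · simp [hxe, hxe₀]

theorem endValue_eq [Finite E] [Finite F] (hK : K.IsPseudosurface) (he₀ : e₀ ∈ A.EMII)
    (he : e ∈ A.EMII) : (B.path₁ e).endValue e e₀ = (B.path₂ e).endValue e e₀ := by
  have := Fintype.ofFinite F
  obtain ⟨σ, hσ⟩ := P.exists_isSigning hK
  have hjoin := A.joins e
  have hjoin₀ := B.joins e
  have heS := notMem_S_of_mem_EM e.2
  have hend₁ := (B.path₁ e).mul_endValue_eq_neg hK hσ (B.isPath₁ e).2 hjoin heS hjoin₀.2.1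
  have hend₂ :=
    (B.path₂ e).mul_endValue_eq_neg hK hσ (B.isPath₂ e).2 hjoin.symm heS hjoin₀.2.2
  -- With respect to `σ`, the two faces at a torsion edge induce the same orientation on it.
  rw [(hσ.vecMul_ne_zero_iff hK hjoin₀).1 ((mem_EMII_iff hK hσ).1 he₀),
    (hσ.vecMul_ne_zero_iff hK hjoin).1 ((mem_EMII_iff hK hσ).1 he), ← hend₂] at hend₁
  exact mul_left_cancel₀ (hσ.mul_inc_ne_zero hjoin₀.2.2) hend₁

theorem incMatrix_mulVec_cochain [Fintype E] [Finite F] (hK : K.IsPseudosurface)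
    (he₀ : e₀ ∈ A.EMII) (hne : e ≠ e₀) : K.incMatrix *ᵥ B.cochain e = 0 := by
  classical
  by_cases he : e ∈ A.EMII
  · have := Fintype.ofFinite F
    have hjoin := A.joins e
    have hjoin₀ := B.joins e
    have heS := notMem_S_of_mem_EM e.2
    rw [cochain_of_mem_EMII he hne, Matrix.mulVec_add, Matrix.mulVec_sub, Matrix.mulVec_add,
      (B.path₁ e).incMatrix_mulVec_openCochain hK (B.isPath₁ e).2 hjoin heS hjoin₀.2.1,
      (B.path₂ e).incMatrix_mulVec_openCochain hK (B.isPath₂ e).2 hjoin.symm heS hjoin₀.2.2,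
      incMatrix_mulVec_single hK hjoin, incMatrix_mulVec_single hK hjoin₀,
      ← endValue_eq hK he₀ he, mul_one, mul_one]
    abel
  · rw [cochain_of_notMem_EMII he, FirstLoop.incMatrix_mulVec_cochain hK he]

open scoped Classical in
theorem cochain_apply_of_notMem (hne : e ≠ e₀) {x : E} (hx : x ∉ P.S) (hx₀ : x ≠ e₀) :
    B.cochain e x = (Pi.single e.1 1 : E → ℝ) x := by
  by_cases he : e ∈ A.EMII
  · simp [cochain_of_mem_EMII he hne, DualWalk.openCochain_apply_of_notMem _ _ hx, hx₀]
  · rw [cochain_of_notMem_EMII he, FirstLoop.cochain_apply_of_notMem he hx]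

theorem cochain_mem_relCocycles [Fintype E] [Finite F] (hK : K.IsPseudosurface)
    (he₀ : e₀ ∈ A.EMII) (hne : e ≠ e₀) : B.cochain e ∈ P.relCocycles := by
  classical
  refine mem_relCocycles_iff_support.2
    ⟨incMatrix_mulVec_cochain hK he₀ hne, fun x hx hxM => ?_⟩
  rw [cochain_apply_of_notMem hne hx (ne_of_mem_of_not_mem e₀.2 hxM).symm,
    Pi.single_eq_of_ne (ne_of_mem_of_not_mem e.2 hxM).symm]

theorem representsBasis_cochain [Finite V] [Finite E] [Finite F] (hK : K.IsPseudosurface)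
    (he₀ : e₀ ∈ A.EMII) (B : A.SecondLoop e₀) :
    K.RepresentsBasis fun e : {e : P.EM // e ≠ e₀} => B.cochain e.1 := by
  classical
  have := Fintype.ofFinite E
  have := Fintype.ofFinite F
  obtain ⟨σ, hσ⟩ := P.exists_isSigning hK
  have happly (e e' : {e : P.EM // e ≠ e₀}) :
      B.cochain e.1 e'.1 = (Pi.single e.1.1 1 : E → ℝ) e'.1 :=
    cochain_apply_of_notMem e.2 (notMem_S_of_mem_EM e'.1.2) (Subtype.coe_ne_coe.2 e'.2)
  refine representsBasis_of_dual (j := fun e => e.1.1)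
    (fun e => cochain_mem_relCocycles hK he₀ e.2) (fun e => ?_) (fun e e' hne => ?_)
    fun c hc hEM => eq_zero_of_mem_relCocycles_of_isSigning hK hσ ((mem_EMII_iff hK hσ).1 he₀) hc
      fun e he hne => hEM ⟨⟨e, he⟩, Subtype.coe_ne_coe.1 hne⟩
  · rw [happly, Pi.single_eq_same]
  · rw [happly, Pi.single_eq_of_ne (Subtype.coe_ne_coe.2 (Subtype.coe_ne_coe.2 hne.symm))]

end SecondLoop

end FirstLoop

end TreePair

end TriComplex

theorem mainTheorem3_general {V E F : Type*} [Finite V] [Finite E] [Finite F]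
    (K : TriComplex V E F) (hK : K.IsPseudosurface) (P : K.TreePair) (A : P.FirstLoop) :
    (A.EMII = ∅ → K.RepresentsBasis A.cochain) ∧
    (∀ e₀ ∈ A.EMII, ∀ B : A.SecondLoop e₀,
      K.RepresentsBasis (fun e : {e : P.EM // e ≠ e₀} => B.cochain e.1)) :=
  ⟨TriComplex.TreePair.FirstLoop.representsBasis_cochain hK,
    fun _ he₀ => TriComplex.TreePair.FirstLoop.SecondLoop.representsBasis_cochain hK he₀⟩

theorem mainTheorem3 {V E F : Type*} [Finite V] [Finite E] [Finite F]
    (K : TriComplex V E F) (hK : K.IsSurface) (P : K.TreePair) (A : P.FirstLoop) :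
    (A.EMII = ∅ → K.RepresentsBasis A.cochain) ∧
    (∀ e₀ ∈ A.EMII, ∀ B : A.SecondLoop e₀,
      K.RepresentsBasis (fun e : {e : P.EM // e ≠ e₀} => B.cochain e.1)) :=
  mainTheorem3_general K hK.edge_faces P A
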